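/- Let $\lambda$ be a partition of $n$, identified with its Young diagram. A standard Young tableau $T$ of shape $\lambda$ is a filling of the cells of $\lambda$ with $1,\dots,n$, each used once, such that rows and columns are increasing; $T$ has a descent at $i$ ($1\le i<n$) if the entry $i+1$ lies strictly south (and weakly west) of the entry $i$, and $D(T)$ is the set of descents. For $f\colon\{1,2,\dots\}\to\mathbb R$ put $d_f(T)=\sum_{i\in D(T)}f(i)$, and let $E_\lambda(d_f)$ and $V_\lambda(d_f)$ be the expectation and the variance of $d_f$ over uniformly distributed standard Young tableaux of shape $\lambda$. Let $f$ be positive: $f(i)>0$ for all $i\ge 1$. The following are equivalent. (i) For every sequence $(\lambda^m)_m$ of partitions (of arbitrary sizes) each having at least two rows, the sequence of normalized variances $V_{\lambda^m}(d_f)/E_{\lambda^m}(d_f)^2$ is bounded. (ii) There is a constant $c$ such that for all $n\ge 2$ $$ n\sum_{i=1}^{n-1} f(i)^2 \le c\Bigl(\sum_{i=1}^{n-1} f(i)\Bigr)^2 .$$ (iii) There is a constant $c$ such that for all $n\ge 2$ one has $\|f\|_{2,n}\le c\,\|f\|_{1,n}$, where $\|f\|_{p,n}=\bigl(\frac1{n-1}\sum_{i=1}^{n-1}|f(i)|^p\bigr)^{1/p}$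 is the normalized $L^p$ norm of $f$ on $\{1,\dots,n-1\}$. (Partitions with a single row are excluded since for them $d_f=0$, so that the ratio $V/E^2$ is undefined.) -/

import Mathlib

/-- A filling of the cells of the Young diagram `μ` with `1, …, n` (`n = μ.card`), each number
being used exactly once, is standard if its rows and its columns are increasing. Cells are pairs
`(row, column)`, with rows numbered downwards (southwards) and columns to the right (eastwards). -/
def IsStandardFilling (μ : YoungDiagram)
    (T : {x // x ∈ μ.cells} ≃ {k // k ∈ Finset.Icc 1 μ.card}) : Prop :=
  (∀ x y : {x // x ∈ μ.cells}, x.1.1 = y.1.1 → x.1.2 < y.1.2 → (T x).1 < (T y).1) ∧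
  (∀ x y : {x // x ∈ μ.cells}, x.1.2 = y.1.2 → x.1.1 < y.1.1 → (T x).1 < (T y).1)

instance instDecidableIsStandardFilling (μ : YoungDiagram)
    (T : {x // x ∈ μ.cells} ≃ {k // k ∈ Finset.Icc 1 μ.card}) :
    Decidable (IsStandardFilling μ T) := by
  unfold IsStandardFilling; infer_instance

/-- The (finite) type of standard Young tableaux of shape `μ`. -/
abbrev StandardTableau (μ : YoungDiagram) : Type :=
  {T : {x // x ∈ μ.cells} ≃ {k // k ∈ Finset.Icc 1 μ.card} // IsStandardFilling μ T}

/-- `T` has a descent at `i`: the entry `i + 1` lies strictly south and weakly west of the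
entry `i`. -/
def HasDescentAt {μ : YoungDiagram} (T : StandardTableau μ) (i : ℕ) : Prop :=
  ∃ x y : {x // x ∈ μ.cells}, (T.1 x).1 = i ∧ (T.1 y).1 = i + 1 ∧
    x.1.1 < y.1.1 ∧ y.1.2 ≤ x.1.2

instance instDecidableHasDescentAt {μ : YoungDiagram} (T : StandardTableau μ) (i : ℕ) :
    Decidable (HasDescentAt T i) := by
  unfold HasDescentAt; infer_instance

/-- The descent set `D(T) ⊆ {1, …, n - 1}`. -/
def descentSet {μ : YoungDiagram} (T : StandardTableau μ) : Finset ℕ :=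
  (Finset.Ico 1 μ.card).filter (fun i => HasDescentAt T i)

/-- The descent function `d_f(T) = ∑_{i ∈ D(T)} f i`. -/
def descentFunction (f : ℕ → ℝ) {μ : YoungDiagram} (T : StandardTableau μ) : ℝ :=
  ∑ i ∈ descentSet T, f i

/-- The expectation of `d_f` over uniformly distributed standard Young tableaux of shape `μ`. -/
noncomputable def descentExpectation (μ : YoungDiagram) (f : ℕ → ℝ) : ℝ :=
  (Finset.univ : Finset (StandardTableau μ)).expect fun T => descentFunction f T

/-- The variance of `d_f` over uniformly distributed standard Young tableaux of shape `μ`. -/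
noncomputable def descentVariance (μ : YoungDiagram) (f : ℕ → ℝ) : ℝ :=
  (Finset.univ : Finset (StandardTableau μ)).expect fun T =>
    (descentFunction f T - descentExpectation μ f) ^ 2

/-- The normalized variance `V(d_f) / E(d_f)²`. -/
noncomputable def normalizedVariance (μ : YoungDiagram) (f : ℕ → ℝ) : ℝ :=
  descentVariance μ f / descentExpectation μ f ^ 2

/-- The normalized `L^p` norm of `f` on `{1, …, n - 1}`, that is, the `L^p` norm with respect to
the uniform probability measure: `((1/(n-1)) ∑_{i=1}^{n-1} |f i|^p)^{1/p}`. -/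
noncomputable def normalizedLpNorm (p : ℝ) (n : ℕ) (f : ℕ → ℝ) : ℝ :=
  ((Finset.Ico 1 n).expect fun i => |f i| ^ p) ^ (1 / p)

/-! Write n for the size of the shape, S and Q for the sums of `f i` and `f i ^ 2` over 1 ≤ i < n,
and k for the number of cells below the first row. Dual Knuth transformations carry descents at `i`
bijectively to descents at `i + 1`. Hence the probability p of a descent does not depend on its
position, nor does the probability q of descents at two given positions at distance at least 2
(`descentProb_eq`, `descentPairProb_eq`). So E = pS, and the second moment is at most 3pQ + qS².

Swapping consecutive entries ties p to the sum of the contents of the shape, which gives k ≤ 2(n -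
1)p (`cellsBelow_le_descentProb`). No tableau has more than k descents, so counting pairs of distant
descents yields q ≤ 48p² (`descentPairProb_le_sq`). Hence V/E² ≤ 3Q/(pS²) + 48. With at least two
rows k ≥ 1, so 1/p ≤ 2(n - 1), and (ii) implies (i).

Conversely, the shape (n - 1, 1) has k = 1, so p ≤ 1/(n - 1), while the second moment is at least
pQ. A bound on V/E² therefore bounds Q/(pS²), which is (ii). Squaring turns (iii) into (ii) with n -
1 in place of n, a harmless change since n ≤ 2(n - 1). -/

namespace StandardTableau

/-! ### Contents of entries and descents -/

variable {μ : YoungDiagram}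

/-- The cell holding the entry `i` (and the cell `(0, 0)` if there is no such entry). -/
def cellAt (T : StandardTableau μ) (i : ℕ) : ℕ × ℕ :=
  if h : i ∈ Finset.Icc 1 μ.card then (T.1.symm ⟨i, h⟩).1 else (0, 0)

/-- The content of the cell holding the entry `i`. -/
def content (T : StandardTableau μ) (i : ℕ) : ℤ :=
  ((T.cellAt i).2 : ℤ) - (T.cellAt i).1

theorem cellAt_entry (T : StandardTableau μ) (x : {x // x ∈ μ.cells}) :
    T.cellAt (T.1 x).1 = x.1 := by
  have h := (T.1 x).2
  simp only [cellAt, h, dif_pos, Subtype.coe_eta, Equiv.symm_apply_apply]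

theorem cellAt_of_entry_eq (T : StandardTableau μ) {x : {x // x ∈ μ.cells}} {i : ℕ}
    (h : (T.1 x).1 = i) : T.cellAt i = x.1 := by
  rw [← h, cellAt_entry]

theorem exists_entry_eq (T : StandardTableau μ) {i : ℕ} (hi : i ∈ Finset.Icc 1 μ.card) :
    ∃ x : {x // x ∈ μ.cells}, (T.1 x).1 = i ∧ T.cellAt i = x.1 := by
  refine ⟨T.1.symm ⟨i, hi⟩, by simp, by simp only [cellAt, hi, dif_pos]⟩

theorem entry_le_entry (T : StandardTableau μ) {x y : {x // x ∈ μ.cells}}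
    (h₁ : x.1.1 ≤ y.1.1) (h₂ : x.1.2 ≤ y.1.2) : (T.1 x).1 ≤ (T.1 y).1 := by
  have hz : (x.1.1, y.1.2) ∈ μ.cells := by
    have := μ.up_left_mem h₁ le_rfl ((YoungDiagram.mem_cells _).1 y.2)
    simpa using this
  have a : (T.1 x).1 ≤ (T.1 ⟨_, hz⟩).1 := by
    rcases h₂.eq_or_lt with h | h
    · have e : x = ⟨_, hz⟩ := Subtype.ext (Prod.ext rfl h)
      exact (congrArg (fun z => (T.1 z).1) e).le
    · exact (T.2.1 x ⟨_, hz⟩ rfl h).le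
  have b : (T.1 ⟨_, hz⟩).1 ≤ (T.1 y).1 := by
    rcases h₁.eq_or_lt with h | h
    · have e : ⟨_, hz⟩ = y := Subtype.ext (Prod.ext h rfl)
      exact (congrArg (fun z => (T.1 z).1) e).le
    · exact (T.2.2 ⟨_, hz⟩ y rfl h).le
  exact a.trans b

theorem entry_lt_entry (T : StandardTableau μ) {x y : {x // x ∈ μ.cells}}
    (h₁ : x.1.1 ≤ y.1.1) (h₂ : x.1.2 ≤ y.1.2) (h : x.1.1 < y.1.1 ∨ x.1.2 < y.1.2) :
    (T.1 x).1 < (T.1 y).1 := by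
  refine lt_of_le_of_ne (T.entry_le_entry h₁ h₂) fun e => ?_
  have : x = y := T.1.injective (Subtype.ext e)
  subst this
  omega

/-- A cell strictly south and strictly east of the cell of `i` holds an entry at least `i + 3`. -/
theorem entry_add_three_le (T : StandardTableau μ) {x y : {x // x ∈ μ.cells}}
    (h₁ : x.1.1 < y.1.1) (h₂ : x.1.2 < y.1.2) : (T.1 x).1 + 3 ≤ (T.1 y).1 := by
  have hy := (YoungDiagram.mem_cells _).1 y.2
  -- The neighbours of `x` to the south and to the east hold two distinct entries strictly between
  -- those of `x` and `y`.
  let u : {x // x ∈ μ.cells} := ⟨(x.1.1 + 1, x.1.2),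
    (YoungDiagram.mem_cells _).2 (μ.up_left_mem (j2 := y.1.2) (i2 := y.1.1) h₁ h₂.le hy)⟩
  let v : {x // x ∈ μ.cells} := ⟨(x.1.1, x.1.2 + 1),
    (YoungDiagram.mem_cells _).2 (μ.up_left_mem (j2 := y.1.2) (i2 := y.1.1) h₁.le h₂ hy)⟩
  have hxu : (T.1 x).1 < (T.1 u).1 := T.entry_lt_entry (by simp [u]) (by simp [u]) (by simp [u])
  have hxv : (T.1 x).1 < (T.1 v).1 := T.entry_lt_entry (by simp [v]) (by simp [v]) (by simp [v])
  have huy : (T.1 u).1 < (T.1 y).1 := T.entry_lt_entry (x := u) h₁ h₂.le (Or.inr h₂)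
  have hvy : (T.1 v).1 < (T.1 y).1 := T.entry_lt_entry (x := v) h₁.le h₂ (Or.inl h₁)
  have huv : (T.1 u).1 ≠ (T.1 v).1 := fun e => by
    have := congrArg (fun z : {x // x ∈ μ.cells} => z.1.1) (T.1.injective (Subtype.ext e))
    simp [u, v] at this
  omega

/-- Along a diagonal, entries grow by at least 3 from one cell to the next. -/
theorem content_ne (T : StandardTableau μ) {i j : ℕ} (hi : i ∈ Finset.Icc 1 μ.card)
    (hj : j ∈ Finset.Icc 1 μ.card) (hij : i < j) (hj3 : j < i + 3) :
    T.content i ≠ T.content j := by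
  obtain ⟨x, hx, hx'⟩ := T.exists_entry_eq hi
  obtain ⟨y, hy, hy'⟩ := T.exists_entry_eq hj
  intro h
  simp only [content, hx', hy'] at h
  rcases lt_or_ge x.1.1 y.1.1 with h₁ | h₁
  · have := T.entry_add_three_le h₁ (by omega)
    omega
  · have := T.entry_le_entry (x := y) (y := x) h₁ (by omega)
    omega

theorem hasDescentAt_iff_content (T : StandardTableau μ) {i : ℕ} (hi : i ∈ Finset.Ico 1 μ.card) :
    HasDescentAt T i ↔ T.content (i + 1) < T.content i := by
  rw [Finset.mem_Ico] at hi
  constructor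
  · rintro ⟨x, y, hx, hy, h₁, h₂⟩
    rw [content, content, T.cellAt_of_entry_eq hx, T.cellAt_of_entry_eq hy]
    omega
  · intro h
    obtain ⟨x, hx, hx'⟩ := T.exists_entry_eq (i := i) (Finset.mem_Icc.2 ⟨hi.1, hi.2.le⟩)
    obtain ⟨y, hy, hy'⟩ := T.exists_entry_eq (i := i + 1) (Finset.mem_Icc.2 ⟨by omega, hi.2⟩)
    simp only [content, hx', hy'] at h
    have h₁ : x.1.1 < y.1.1 := by
      by_contra h₁
      have := T.entry_le_entry (x := y) (y := x) (by omega) (by omega)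
      omega
    refine ⟨x, y, hx, hy, h₁, ?_⟩
    by_contra h₂
    have := T.entry_add_three_le h₁ (by omega)
    omega

theorem mem_descentSet_iff (T : StandardTableau μ) {i : ℕ} (hi : i ∈ Finset.Ico 1 μ.card) :
    i ∈ descentSet T ↔ T.content (i + 1) < T.content i := by
  rw [descentSet, Finset.mem_filter, T.hasDescentAt_iff_content hi, and_iff_right hi]

/-! ### Swapping consecutive entries -/

/-- The transposition of `m` and `m + 1` acting on the entries. -/
def entrySwap (n m : ℕ) (hm : m ∈ Finset.Ico 1 n) : Equiv.Perm {k // k ∈ Finset.Icc 1 n} :=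
  Equiv.swap ⟨m, Finset.mem_Icc.2 ⟨(Finset.mem_Ico.1 hm).1, (Finset.mem_Ico.1 hm).2.le⟩⟩
    ⟨m + 1, Finset.mem_Icc.2 ⟨Nat.le_add_left 1 m, (Finset.mem_Ico.1 hm).2⟩⟩

theorem coe_entrySwap {n m : ℕ} (hm : m ∈ Finset.Ico 1 n) (k : {k // k ∈ Finset.Icc 1 n}) :
    (entrySwap n m hm k).1 = Equiv.swap m (m + 1) k.1 := by
  simp only [entrySwap, Equiv.swap_apply_def, Subtype.ext_iff]
  split_ifs <;> rfl

/-- The swap could only break a row or column containing both `m` and `m + 1`. With contents at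
least 2 apart, such a line would have a cell between the two, with an entry strictly between `m` and
`m + 1`. -/
theorem isStandardFilling_entrySwap (T : StandardTableau μ) {m : ℕ} (hm : m ∈ Finset.Ico 1 μ.card)
    (h : 2 ≤ |T.content m - T.content (m + 1)|) :
    IsStandardFilling μ (T.1.trans (entrySwap μ.card m hm)) := by
  have key : ∀ x y : {x // x ∈ μ.cells}, (T.1 x).1 < (T.1 y).1 →
      ¬ ((T.1 x).1 = m ∧ (T.1 y).1 = m + 1) →
      ((T.1.trans (entrySwap μ.card m hm)) x).1 < ((T.1.trans (entrySwap μ.card m hm)) y).1 := by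
    intro x y hxy hne
    simp only [Equiv.trans_apply, coe_entrySwap, Equiv.swap_apply_def]
    split_ifs <;> omega
  constructor
  · intro x y h₁ h₂
    refine key x y (T.2.1 x y h₁ h₂) ?_
    rintro ⟨hx, hy⟩
    rw [content, content, T.cellAt_of_entry_eq hx, T.cellAt_of_entry_eq hy, le_abs] at h
    let v : {x // x ∈ μ.cells} := ⟨(x.1.1, x.1.2 + 1), (YoungDiagram.mem_cells _).2
      (μ.up_left_mem (j2 := y.1.2) (i2 := y.1.1) h₁.le h₂ ((YoungDiagram.mem_cells _).1 y.2))⟩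
    have a : (T.1 x).1 < (T.1 v).1 := T.2.1 x v rfl (Nat.lt_succ_self _)
    have b : (T.1 v).1 < (T.1 y).1 := T.2.1 v y h₁ (by change x.1.2 + 1 < _; omega)
    omega
  · intro x y h₁ h₂
    refine key x y (T.2.2 x y h₁ h₂) ?_
    rintro ⟨hx, hy⟩
    rw [content, content, T.cellAt_of_entry_eq hx, T.cellAt_of_entry_eq hy, le_abs] at h
    let v : {x // x ∈ μ.cells} := ⟨(x.1.1 + 1, x.1.2), (YoungDiagram.mem_cells _).2
      (μ.up_left_mem (j2 := y.1.2) (i2 := y.1.1) h₂ h₁.le ((YoungDiagram.mem_cells _).1 y.2))⟩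
    have a : (T.1 x).1 < (T.1 v).1 := T.2.2 x v rfl (Nat.lt_succ_self _)
    have b : (T.1 v).1 < (T.1 y).1 := T.2.2 v y h₁ (by change x.1.1 + 1 < _; omega)
    omega

/-- Exchange the entries `m` and `m + 1` if their cells are not adjacent. -/
def adjacentSwap (m : ℕ) (T : StandardTableau μ) : StandardTableau μ :=
  if h : ∃ _ : m ∈ Finset.Ico 1 μ.card, 2 ≤ |T.content m - T.content (m + 1)| then
    ⟨T.1.trans (entrySwap μ.card m h.1), T.isStandardFilling_entrySwap h.1 h.2⟩
  else T

theorem adjacentSwap_eq_self {m : ℕ} {T : StandardTableau μ}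
    (h : |T.content m - T.content (m + 1)| < 2) : T.adjacentSwap m = T :=
  dif_neg fun ⟨_, h'⟩ => absurd h' h.not_ge

theorem adjacentSwap_val {m : ℕ} {T : StandardTableau μ} (hm : m ∈ Finset.Ico 1 μ.card)
    (h : 2 ≤ |T.content m - T.content (m + 1)|) :
    (T.adjacentSwap m).1 = T.1.trans (entrySwap μ.card m hm) := by
  rw [adjacentSwap, dif_pos ⟨hm, h⟩]

theorem content_adjacentSwap {m : ℕ} {T : StandardTableau μ} (hm : m ∈ Finset.Ico 1 μ.card)
    (h : 2 ≤ |T.content m - T.content (m + 1)|) (i : ℕ) :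
    (T.adjacentSwap m).content i = T.content (Equiv.swap m (m + 1) i) := by
  suffices H : (T.adjacentSwap m).cellAt i = T.cellAt (Equiv.swap m (m + 1) i) by
    rw [content, content, H]
  by_cases hi : i ∈ Finset.Icc 1 μ.card
  · obtain ⟨x, hx, hx'⟩ := (T.adjacentSwap m).exists_entry_eq hi
    rw [hx', eq_comm]
    apply T.cellAt_of_entry_eq
    rw [adjacentSwap_val hm h, Equiv.trans_apply, coe_entrySwap] at hx
    rw [← hx, Equiv.swap_apply_self]
  · have : Equiv.swap m (m + 1) i = i := by
      rw [Finset.mem_Icc] at hi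
      rw [Finset.mem_Ico] at hm
      apply Equiv.swap_apply_of_ne_of_ne <;> omega
    rw [this, cellAt, cellAt, dif_neg hi, dif_neg hi]

theorem adjacentSwap_involutive {m : ℕ} (hm : m ∈ Finset.Ico 1 μ.card) :
    Function.Involutive (adjacentSwap m : StandardTableau μ → StandardTableau μ) := by
  intro T
  by_cases h : 2 ≤ |T.content m - T.content (m + 1)|
  · have h' : 2 ≤ |(T.adjacentSwap m).content m - (T.adjacentSwap m).content (m + 1)| := by
      rwa [content_adjacentSwap hm h, content_adjacentSwap hm h, Equiv.swap_apply_left,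
        Equiv.swap_apply_right, abs_sub_comm]
    apply Subtype.ext
    rw [adjacentSwap_val hm h', adjacentSwap_val hm h]
    ext x
    simp [entrySwap]
  · rw [adjacentSwap_eq_self (not_le.1 h), adjacentSwap_eq_self (not_le.1 h)]

/-! ### Dual Knuth transformations -/

/-- The elementary dual Knuth transformation of the entries `i`, `i + 1`, `i + 2`. -/
def dualKnuth (i : ℕ) (T : StandardTableau μ) : StandardTableau μ :=
  -- The three contents are distinct when these entries exist. The tests ask whether `i`,
  -- respectively `i + 2`, has the middle one; the other two entries are then swapped, their
  -- contents being at least 2 apart. If `i + 1` has it, nothing moves.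
  if (T.content (i + 1) < T.content i ↔ T.content i < T.content (i + 2)) then
    T.adjacentSwap (i + 1)
  else if (T.content i < T.content (i + 2) ↔ T.content (i + 2) < T.content (i + 1)) then
    T.adjacentSwap i
  else T

section DualKnuth

variable {i : ℕ}

theorem dualKnuth_cases (hi : 1 ≤ i) (hi' : i + 2 ≤ μ.card) (T : StandardTableau μ) :
    (T.dualKnuth i = T.adjacentSwap (i + 1) ∧
      (T.content (i + 1) < T.content i ↔ T.content i < T.content (i + 2)) ∧
      (T.dualKnuth i).content i = T.content i ∧
      (T.dualKnuth i).content (i + 1) = T.content (i + 2) ∧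
      (T.dualKnuth i).content (i + 2) = T.content (i + 1)) ∨
    (T.dualKnuth i = T.adjacentSwap i ∧
      ¬ (T.content (i + 1) < T.content i ↔ T.content i < T.content (i + 2)) ∧
      (T.content i < T.content (i + 2) ↔ T.content (i + 2) < T.content (i + 1)) ∧
      (T.dualKnuth i).content i = T.content (i + 1) ∧
      (T.dualKnuth i).content (i + 1) = T.content i ∧
      (T.dualKnuth i).content (i + 2) = T.content (i + 2)) ∨
    (T.dualKnuth i = T ∧
      ¬ (T.content (i + 1) < T.content i ↔ T.content i < T.content (i + 2)) ∧
      ¬ (T.content i < T.content (i + 2) ↔ T.content (i + 2) < T.content (i + 1))) := by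
  have h₁ := T.content_ne (i := i) (j := i + 1) (by simp; omega) (by simp; omega)
    (by omega) (by omega)
  have h₂ := T.content_ne (i := i) (j := i + 2) (by simp; omega) (by simp; omega)
    (by omega) (by omega)
  have h₃ := T.content_ne (i := i + 1) (j := i + 2) (by simp; omega) (by simp; omega)
    (by omega) (by omega)
  by_cases hA : T.content (i + 1) < T.content i ↔ T.content i < T.content (i + 2)
  · have e : T.dualKnuth i = T.adjacentSwap (i + 1) := if_pos hA
    have hm : i + 1 ∈ Finset.Ico 1 μ.card := by simp; omega
    have hd : 2 ≤ |T.content (i + 1) - T.content (i + 1 + 1)| := by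
      rw [le_abs, show i + 1 + 1 = i + 2 from rfl]
      omega
    refine Or.inl ⟨e, hA, ?_, ?_, ?_⟩ <;> rw [e, content_adjacentSwap hm hd]
    · rw [Equiv.swap_apply_of_ne_of_ne] <;> omega
    · rw [Equiv.swap_apply_left]
    · rw [Equiv.swap_apply_right]
  · by_cases hB : T.content i < T.content (i + 2) ↔ T.content (i + 2) < T.content (i + 1)
    · have e : T.dualKnuth i = T.adjacentSwap i := by rw [dualKnuth, if_neg hA, if_pos hB]
      have hm : i ∈ Finset.Ico 1 μ.card := by simp; omega
      have hd : 2 ≤ |T.content i - T.content (i + 1)| := by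
        rw [le_abs]
        omega
      refine Or.inr (Or.inl ⟨e, hA, hB, ?_, ?_, ?_⟩) <;> rw [e, content_adjacentSwap hm hd]
      · rw [Equiv.swap_apply_left]
      · rw [Equiv.swap_apply_right]
      · rw [Equiv.swap_apply_of_ne_of_ne] <;> omega
    · exact Or.inr (Or.inr ⟨by rw [dualKnuth, if_neg hA, if_neg hB], hA, hB⟩)

/-- The entry with the middle content stays in place, so the second application takes the same
branch and undoes the swap. -/
theorem dualKnuth_involutive (hi : 1 ≤ i) (hi' : i + 2 ≤ μ.card) :
    Function.Involutive (dualKnuth i : StandardTableau μ → StandardTableau μ) := by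
  intro T
  have h₁ := T.content_ne (i := i) (j := i + 1) (by simp; omega) (by simp; omega)
    (by omega) (by omega)
  have h₂ := T.content_ne (i := i) (j := i + 2) (by simp; omega) (by simp; omega)
    (by omega) (by omega)
  have h₃ := T.content_ne (i := i + 1) (j := i + 2) (by simp; omega) (by simp; omega)
    (by omega) (by omega)
  have hm : i ∈ Finset.Ico 1 μ.card := by simp; omega
  have hm' : i + 1 ∈ Finset.Ico 1 μ.card := by simp; omega
  rcases dualKnuth_cases hi hi' T with ⟨e, hA, a, b, c⟩ | ⟨e, hA, hB, a, b, c⟩ | ⟨e, hA, hB⟩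
  · rw [dualKnuth, if_pos (by rw [a, b, c]; omega), e, adjacentSwap_involutive hm']
  · rw [dualKnuth, if_neg (by rw [a, b, c]; omega), if_pos (by rw [a, b, c]; omega), e,
      adjacentSwap_involutive hm]
  · rw [e, e]

theorem content_dualKnuth_of_disjoint (hi : 1 ≤ i) (hi' : i + 2 ≤ μ.card) (T : StandardTableau μ)
    {j : ℕ} (hj : j < i ∨ i + 2 < j) : (T.dualKnuth i).content j = T.content j := by
  have key : ∀ m, (m = i ∨ m = i + 1) → (T.adjacentSwap m).content j = T.content j := by
    intro m hm
    by_cases hd : 2 ≤ |T.content m - T.content (m + 1)|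
    · rw [content_adjacentSwap (by simp; omega) hd, Equiv.swap_apply_of_ne_of_ne] <;> omega
    · rw [adjacentSwap_eq_self (not_le.1 hd)]
  rw [dualKnuth]
  split_ifs
  exacts [key _ (Or.inr rfl), key _ (Or.inl rfl), rfl]

/-- If `i + 1` has the middle content, then `i` and `i + 1` are both descents or both not. Otherwise
exactly one of them is a descent, and the swap exchanges their roles. -/
theorem succ_mem_descentSet_dualKnuth (hi : 1 ≤ i) (hi' : i + 2 ≤ μ.card)
    (T : StandardTableau μ) : i + 1 ∈ descentSet (T.dualKnuth i) ↔ i ∈ descentSet T := by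
  have h₁ := T.content_ne (i := i) (j := i + 1) (by simp; omega) (by simp; omega)
    (by omega) (by omega)
  have h₂ := T.content_ne (i := i) (j := i + 2) (by simp; omega) (by simp; omega)
    (by omega) (by omega)
  have h₃ := T.content_ne (i := i + 1) (j := i + 2) (by simp; omega) (by simp; omega)
    (by omega) (by omega)
  rw [mem_descentSet_iff _ (by simp; omega), mem_descentSet_iff _ (by simp; omega),
    show i + 1 + 1 = i + 2 from rfl]
  rcases dualKnuth_cases hi hi' T with ⟨e, hA, a, b, c⟩ | ⟨e, hA, hB, a, b, c⟩ | ⟨e, hA, hB⟩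
  · rw [b, c]; omega
  · rw [b, c]; omega
  · rw [e]; omega

theorem mem_descentSet_dualKnuth_of_disjoint (hi : 1 ≤ i) (hi' : i + 2 ≤ μ.card)
    (T : StandardTableau μ) {j : ℕ} (hj : j + 1 < i ∨ i + 2 < j) :
    j ∈ descentSet (T.dualKnuth i) ↔ j ∈ descentSet T := by
  by_cases hj' : j ∈ Finset.Ico 1 μ.card
  · rw [mem_descentSet_iff _ hj', mem_descentSet_iff _ hj',
      content_dualKnuth_of_disjoint hi hi' T (by omega),
      content_dualKnuth_of_disjoint hi hi' T (by omega)]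
  · simp only [descentSet, Finset.mem_filter, hj', false_and]

end DualKnuth

end StandardTableau

-- Numbering the cells row by row gives a tableau. Averages over tableaux are therefore genuine, and
-- the average of a constant is that constant.
open Finset in
instance instNonemptyStandardTableau (μ : YoungDiagram) : Nonempty (StandardTableau μ) := by
  let s : Finset (ℕ ×ₗ ℕ) := μ.cells.map toLex.toEmbedding
  have hs : s.card = μ.card := by simp [s, YoungDiagram.card]
  let e : {x // x ∈ s} ≃o Fin μ.card := (s.orderIsoOfFin hs).symm
  have mem : ∀ x : {x // x ∈ μ.cells}, toLex x.1 ∈ s := fun x => by simp [s]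
  let a : {x // x ∈ μ.cells} → {k // k ∈ Icc 1 μ.card} := fun x =>
    ⟨(e ⟨toLex x.1, mem x⟩).1 + 1, by
      have := (e ⟨toLex x.1, mem x⟩).2
      rw [mem_Icc]; omega⟩
  have mono : ∀ x y : {x // x ∈ μ.cells}, toLex x.1 < toLex y.1 → (a x).1 < (a y).1 := by
    intro x y h
    have : e ⟨toLex x.1, mem x⟩ < e ⟨toLex y.1, mem y⟩ := e.lt_iff_lt.2 h
    exact Nat.succ_lt_succ this
  have inj : Function.Injective a := by
    intro x y h
    rcases lt_trichotomy (toLex x.1) (toLex y.1) with h' | h' | h'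
    · exact absurd (congrArg Subtype.val h) (mono x y h').ne
    · exact Subtype.ext (toLex.injective h')
    · exact absurd (congrArg Subtype.val h) (mono y x h').ne'
  have bij : Function.Bijective a :=
    (Fintype.bijective_iff_injective_and_card a).2 ⟨inj, by simp [YoungDiagram.card]⟩
  refine ⟨Equiv.ofBijective a bij, fun x y h₁ h₂ => ?_, fun x y h₁ h₂ => ?_⟩
  · exact mono x y (Prod.Lex.toLex_lt_toLex.2 (Or.inr ⟨h₁, h₂⟩))
  · exact mono x y (Prod.Lex.toLex_lt_toLex.2 (Or.inl h₂))

open Finset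
open scoped BigOperators

namespace StandardTableau

variable {μ : YoungDiagram}

/-- The indicator of a descent at `i`. -/
def descentIndicator (T : StandardTableau μ) (i : ℕ) : ℝ :=
  if i ∈ descentSet T then 1 else 0

theorem descentIndicator_nonneg (T : StandardTableau μ) (i : ℕ) : 0 ≤ T.descentIndicator i := by
  rw [descentIndicator]; split_ifs <;> norm_num

theorem descentIndicator_le_one (T : StandardTableau μ) (i : ℕ) : T.descentIndicator i ≤ 1 := by
  rw [descentIndicator]; split_ifs <;> norm_num

theorem descentIndicator_congr {T U : StandardTableau μ} {i j : ℕ}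
    (h : i ∈ descentSet T ↔ j ∈ descentSet U) : T.descentIndicator i = U.descentIndicator j := by
  simp only [descentIndicator, h]

theorem descentFunction_eq_sum (f : ℕ → ℝ) (T : StandardTableau μ) :
    descentFunction f T = ∑ i ∈ Ico 1 μ.card, f i * T.descentIndicator i := by
  have : descentSet T = (Ico 1 μ.card).filter (· ∈ descentSet T) := by
    ext i; simp only [descentSet, mem_filter]; tauto
  simp only [descentFunction, descentIndicator, mul_ite, mul_one, mul_zero]
  rw [← sum_filter, ← this]

theorem sum_descentIndicator (T : StandardTableau μ) :
    ∑ i ∈ Ico 1 μ.card, T.descentIndicator i = (descentSet T).card := by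
  simpa [descentFunction] using (descentFunction_eq_sum (fun _ => 1) T).symm

end StandardTableau

open StandardTableau

variable {μ : YoungDiagram}

/-! ### Independence of descent probabilities from position -/

/-- The probability of a descent at `i`. -/
noncomputable def descentProb (μ : YoungDiagram) (i : ℕ) : ℝ :=
  𝔼 T : StandardTableau μ, T.descentIndicator i

/-- The probability of descents at both `i` and `j`. -/
noncomputable def descentPairProb (μ : YoungDiagram) (i j : ℕ) : ℝ :=
  𝔼 T : StandardTableau μ, T.descentIndicator i * T.descentIndicator j

theorem descentProb_succ {i : ℕ} (hi : 1 ≤ i) (hi' : i + 2 ≤ μ.card) :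
    descentProb μ (i + 1) = descentProb μ i :=
  Eq.symm <| Fintype.expect_bijective _ (dualKnuth_involutive hi hi').bijective _ _ fun T =>
    descentIndicator_congr (succ_mem_descentSet_dualKnuth hi hi' T).symm

/-- `dualKnuth i` can affect descents at `i - 1`, …, `i + 2`, so `j` must lie beyond this range. -/
theorem descentPairProb_succ_left {i j : ℕ} (hi : 1 ≤ i) (hij : i + 3 ≤ j) (hj : j < μ.card) :
    descentPairProb μ (i + 1) j = descentPairProb μ i j :=
  have hi' : i + 2 ≤ μ.card := by omega
  Eq.symm <| Fintype.expect_bijective _ (dualKnuth_involutive hi hi').bijective _ _ fun T =>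
    congrArg₂ (· * ·) (descentIndicator_congr (succ_mem_descentSet_dualKnuth hi hi' T).symm)
      (descentIndicator_congr (mem_descentSet_dualKnuth_of_disjoint hi hi' T (by omega)).symm)

theorem descentPairProb_succ_right {i j : ℕ} (hij : i + 2 ≤ j) (hj : j + 2 ≤ μ.card) :
    descentPairProb μ i (j + 1) = descentPairProb μ i j :=
  have hj' : 1 ≤ j := by omega
  Eq.symm <| Fintype.expect_bijective _ (dualKnuth_involutive hj' hj).bijective _ _ fun T =>
    congrArg₂ (· * ·)
      (descentIndicator_congr (mem_descentSet_dualKnuth_of_disjoint hj' hj T (by omega)).symm)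
      (descentIndicator_congr (succ_mem_descentSet_dualKnuth hj' hj T).symm)

theorem descentProb_eq {i : ℕ} (hi : i ∈ Ico 1 μ.card) : descentProb μ i = descentProb μ 1 := by
  obtain ⟨h₁, h₂⟩ := mem_Ico.1 hi
  induction i, h₁ using Nat.le_induction with
  | base => rfl
  | succ i h ih => rw [descentProb_succ h (by omega), ih (by simp; omega) (by omega)]

theorem descentPairProb_eq {i j : ℕ} (hi : 1 ≤ i) (hij : i + 2 ≤ j) (hj : j < μ.card) :
    descentPairProb μ i j = descentPairProb μ 1 3 := by
  have right : ∀ {j : ℕ}, i + 2 ≤ j → j < μ.card →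
      descentPairProb μ i j = descentPairProb μ i (i + 2) := by
    intro j h
    induction j, h using Nat.le_induction with
    | base => exact fun _ => rfl
    | succ j h ih =>
      intro hj
      rw [descentPairProb_succ_right h (by omega), ih (by omega)]
  rw [right hij hj]
  have h' : i + 2 < μ.card := by omega
  clear right hij hj
  induction i, hi using Nat.le_induction with
  | base => rfl
  | succ i h ih =>
    -- The pair slides through gap 3: from (i + 1, i + 3) to (i, i + 3), then to (i, i + 2).
    rw [descentPairProb_succ_left h (by omega) h', show i + 1 + 2 = (i + 2) + 1 from rfl,
      descentPairProb_succ_right le_rfl (by omega), ih (by omega)]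

theorem descentPairProb_comm (i j : ℕ) : descentPairProb μ i j = descentPairProb μ j i :=
  expect_congr rfl fun _ _ => mul_comm _ _

theorem descentProb_nonneg (i : ℕ) : 0 ≤ descentProb μ i :=
  expect_nonneg fun T _ => T.descentIndicator_nonneg i

theorem descentPairProb_nonneg (i j : ℕ) : 0 ≤ descentPairProb μ i j :=
  expect_nonneg fun T _ => mul_nonneg (T.descentIndicator_nonneg i) (T.descentIndicator_nonneg j)

theorem descentPairProb_le (i j : ℕ) : descentPairProb μ i j ≤ descentProb μ i :=
  expect_le_expect fun T _ =>
    mul_le_of_le_one_right (T.descentIndicator_nonneg i) (T.descentIndicator_le_one j)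

theorem descentPairProb_self (i : ℕ) : descentPairProb μ i i = descentProb μ i :=
  expect_congr rfl fun T _ => by rw [descentIndicator]; split_ifs <;> norm_num

theorem descentExpectation_eq (f : ℕ → ℝ) :
    descentExpectation μ f = descentProb μ 1 * ∑ i ∈ Ico 1 μ.card, f i := by
  simp only [descentExpectation, descentFunction_eq_sum, expect_sum_comm, ← mul_expect]
  rw [mul_sum]
  exact sum_congr rfl fun i hi => by rw [← descentProb_eq hi, mul_comm, descentProb]

theorem expect_descentFunction_sq (f : ℕ → ℝ) :
    𝔼 T : StandardTableau μ, descentFunction f T ^ 2 =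
      ∑ i ∈ Ico 1 μ.card, ∑ j ∈ Ico 1 μ.card, f i * f j * descentPairProb μ i j := by
  simp only [descentFunction_eq_sum, sq, sum_mul_sum, expect_sum_comm, descentPairProb,
    mul_expect]
  exact sum_congr rfl fun i _ => sum_congr rfl fun j _ => expect_congr rfl fun T _ => by ring

theorem descentVariance_eq (f : ℕ → ℝ) :
    descentVariance μ f =
      𝔼 T : StandardTableau μ, descentFunction f T ^ 2 - descentExpectation μ f ^ 2 := by
  have : ∀ T : StandardTableau μ, (descentFunction f T - descentExpectation μ f) ^ 2 =
      descentFunction f T ^ 2 - 2 * descentExpectation μ f * descentFunction f T +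
        descentExpectation μ f ^ 2 := fun T => by ring
  simp only [descentVariance, this, expect_add_distrib, expect_sub_distrib, ← mul_expect,
    Fintype.expect_const]
  rw [← descentExpectation]
  ring

theorem descentVariance_nonneg (f : ℕ → ℝ) : 0 ≤ descentVariance μ f :=
  expect_nonneg fun _ _ => sq_nonneg _

/-! ### The descent probability from the contents of the shape -/

theorem expect_content_sub {m : ℕ} (hm : m ∈ Ico 1 μ.card) :
    𝔼 T : StandardTableau μ, ((T.content m : ℝ) - T.content (m + 1)) =
      2 * descentProb μ 1 - 1 := by
  -- `g` is odd under `adjacentSwap m`, so its mean vanishes: a genuine swap negates both terms, and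
  -- at a fixed tableau the content difference is ±1, equal to the second term.
  let g : StandardTableau μ → ℝ := fun T =>
    ((T.content m : ℝ) - T.content (m + 1)) - (2 * T.descentIndicator m - 1)
  have hg : ∀ T, g T = - g (T.adjacentSwap m) := by
    intro T
    have hne := T.content_ne (i := m) (j := m + 1) (by simp at hm ⊢; omega)
      (by simp at hm ⊢; omega) (by omega) (by omega)
    by_cases h : 2 ≤ |T.content m - T.content (m + 1)|
    · have e₁ := content_adjacentSwap hm h m
      have e₂ := content_adjacentSwap hm h (m + 1)
      rw [Equiv.swap_apply_left] at e₁
      rw [Equiv.swap_apply_right] at e₂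
      simp only [g, descentIndicator, mem_descentSet_iff _ hm, e₁, e₂]
      rcases lt_or_gt_of_ne hne with h' | h'
      · rw [if_neg h'.not_gt, if_pos h']; ring
      · rw [if_neg h'.not_gt, if_pos h']; ring
    · rw [adjacentSwap_eq_self (not_le.1 h)]
      have h0 : g T = 0 := by
        rw [le_abs] at h
        simp only [g, descentIndicator, mem_descentSet_iff _ hm]
        rcases lt_or_gt_of_ne hne with h' | h'
        · rw [if_neg h'.not_gt, show T.content (m + 1) = T.content m + 1 by omega]
          push_cast; ring
        · rw [if_pos h', show T.content m = T.content (m + 1) + 1 by omega]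
          push_cast; ring
      rw [h0, neg_zero]
  have h0 : 𝔼 T, g T = 0 := by
    have := Fintype.expect_bijective _ (adjacentSwap_involutive hm).bijective g (fun T => - g T) hg
    rw [expect_neg_distrib] at this
    linarith
  simp only [g, expect_sub_distrib, ← mul_expect, Fintype.expect_const] at h0
  rw [← descentProb, descentProb_eq hm] at h0
  rw [expect_sub_distrib]
  linarith

theorem StandardTableau.content_one (T : StandardTableau μ) : T.content 1 = 0 := by
  by_cases h : 1 ∈ Icc 1 μ.card
  · obtain ⟨x, hx, hx'⟩ := T.exists_entry_eq h
    have h0 : ((0, 0) : ℕ × ℕ) ∈ μ.cells := (YoungDiagram.mem_cells _).2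
      (μ.up_left_mem (Nat.zero_le x.1.1) (Nat.zero_le x.1.2) ((YoungDiagram.mem_cells _).1 x.2))
    have h1 := (mem_Icc.1 (T.1 ⟨_, h0⟩).2).1
    by_cases hx0 : x.1.1 = 0 ∧ x.1.2 = 0
    · rw [content, hx', hx0.1, hx0.2]; rfl
    · have := T.entry_lt_entry (x := ⟨_, h0⟩) (y := x) (Nat.zero_le _) (Nat.zero_le _)
        (by dsimp only; omega)
      omega
  · rw [content, cellAt, dif_neg h]; rfl

theorem expect_content {m : ℕ} (hm : m ∈ Icc 1 μ.card) :
    𝔼 T : StandardTableau μ, (T.content m : ℝ) = (m - 1) * (1 - 2 * descentProb μ 1) := by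
  obtain ⟨h₁, h₂⟩ := mem_Icc.1 hm
  clear hm
  induction m, h₁ using Nat.le_induction with
  | base => simp [content_one]
  | succ m h ih =>
    have := expect_content_sub (μ := μ) (m := m) (by simp; omega)
    rw [expect_sub_distrib, ih (by omega)] at this
    push_cast
    linarith

theorem StandardTableau.sum_content (T : StandardTableau μ) :
    ∑ m ∈ Icc 1 μ.card, (T.content m : ℝ) = ∑ x ∈ μ.cells, ((x.2 : ℝ) - x.1) := by
  rw [← sum_coe_sort μ.cells, ← sum_coe_sort (Icc 1 μ.card)]
  refine (Fintype.sum_equiv T.1 _ _ fun x => ?_).symm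
  rw [content, cellAt_entry]
  push_cast
  rfl

theorem sum_cells_content :
    ∑ x ∈ μ.cells, ((x.2 : ℝ) - x.1) =
      μ.card * (μ.card - 1) / 2 * (1 - 2 * descentProb μ 1) := by
  have h := Fintype.expect_const (ι := StandardTableau μ) (∑ x ∈ μ.cells, ((x.2 : ℝ) - x.1))
  rw [← h, expect_congr rfl fun T _ => T.sum_content.symm, expect_sum_comm,
    sum_congr rfl fun m hm => expect_content hm, ← sum_mul]
  congr 1
  generalize μ.card = n
  induction n with
  | zero => simp
  | succ n ih =>
    rw [sum_Icc_succ_top (by omega), ih]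
    push_cast; ring

/-- Reversing each row shows that twice the sum of the column indices is the sum over cells of row
length minus 1, and the first row is the longest. The row indices only lower the left side. -/
theorem two_mul_sum_cells_content_le :
    2 * ∑ x ∈ μ.cells, ((x.2 : ℝ) - x.1) ≤ μ.card * (μ.rowLen 0 - 1) := by
  have hlt : ∀ x ∈ μ.cells, x.2 < μ.rowLen x.1 := fun x hx =>
    YoungDiagram.mem_iff_lt_rowLen.1 ((YoungDiagram.mem_cells _).1 hx)
  have hrefl : ∑ x ∈ μ.cells, (x.2 : ℝ) =
      ∑ x ∈ μ.cells, ((μ.rowLen x.1 : ℝ) - 1 - x.2) := by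
    have hmem : ∀ x ∈ μ.cells, (x.1, μ.rowLen x.1 - 1 - x.2) ∈ μ.cells := fun x hx => by
      have := hlt x hx
      exact (YoungDiagram.mem_cells _).2 (YoungDiagram.mem_iff_lt_rowLen.2 (by omega))
    refine sum_nbij' (fun x => (x.1, μ.rowLen x.1 - 1 - x.2))
      (fun x => (x.1, μ.rowLen x.1 - 1 - x.2)) hmem hmem ?_ ?_ ?_
    · intro x hx
      have := hlt x hx
      exact Prod.ext rfl (by dsimp only; omega)
    · intro x hx
      have := hlt x hx
      exact Prod.ext rfl (by dsimp only; omega)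
    · intro x hx
      have := hlt x hx
      dsimp only
      rw [Nat.sub_sub, Nat.cast_sub (by omega)]
      push_cast; ring
  have hle : ∑ x ∈ μ.cells, ((μ.rowLen x.1 : ℝ) - 1) ≤ μ.card * (μ.rowLen 0 - 1) := by
    rw [← nsmul_eq_mul, YoungDiagram.card, ← sum_const]
    refine sum_le_sum fun x _ => ?_
    have : (μ.rowLen x.1 : ℝ) ≤ μ.rowLen 0 := by
      exact_mod_cast μ.rowLen_anti 0 x.1 (Nat.zero_le _)
    linarith
  have hnn : 0 ≤ ∑ x ∈ μ.cells, (x.1 : ℝ) := sum_nonneg fun _ _ => Nat.cast_nonneg _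
  rw [sum_sub_distrib] at hrefl
  rw [sum_sub_distrib]
  linarith

/-! ### Descents and the cells below the first row -/

/-- The number of cells below the first row. -/
def cellsBelow (μ : YoungDiagram) : ℕ := (μ.cells.filter fun x => 0 < x.1).card

theorem rowLen_zero_add_cellsBelow : μ.rowLen 0 + cellsBelow μ = μ.card := by
  rw [YoungDiagram.rowLen_eq_card, YoungDiagram.row, cellsBelow, YoungDiagram.card,
    ← card_filter_add_card_filter_not (s := μ.cells) (fun x => x.1 = 0)]
  simp only [Nat.pos_iff_ne_zero]

theorem cellsBelow_pos (h : 2 ≤ μ.colLen 0) : 0 < cellsBelow μ :=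
  card_pos.2 ⟨(1, 0), mem_filter.2
    ⟨(YoungDiagram.mem_cells _).2 (YoungDiagram.mem_iff_lt_colLen.2 h), Nat.one_pos⟩⟩

theorem two_le_card (h : 2 ≤ μ.colLen 0) : 2 ≤ μ.card := by
  have h₁ : 0 < μ.rowLen 0 :=
    YoungDiagram.mem_iff_lt_rowLen.1 (YoungDiagram.mem_iff_lt_colLen.2 (by omega))
  have := cellsBelow_pos h
  have := rowLen_zero_add_cellsBelow (μ := μ)
  omega

/-- Each descent `i` contributes a cell below the first row, the one holding `i + 1`. -/
theorem card_descentSet_le (T : StandardTableau μ) : (descentSet T).card ≤ cellsBelow μ := by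
  refine card_le_card_of_injOn (fun i => T.cellAt (i + 1)) ?_ ?_
  · intro i hi
    obtain ⟨x, y, -, hy, h, -⟩ := (mem_filter.1 hi).2
    simp only [T.cellAt_of_entry_eq hy]
    exact mem_coe.2 (mem_filter.2 ⟨y.2, by omega⟩)
  · intro i hi j hj hij
    obtain ⟨-, y, -, hy, -⟩ := (mem_filter.1 hi).2
    obtain ⟨-, z, -, hz, -⟩ := (mem_filter.1 hj).2
    simp only [T.cellAt_of_entry_eq hy, T.cellAt_of_entry_eq hz] at hij
    rw [Subtype.ext hij] at hy
    omega

theorem cellsBelow_le_descentProb (h : 2 ≤ μ.card) :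
    (cellsBelow μ : ℝ) ≤ 2 * (μ.card - 1) * descentProb μ 1 := by
  have h₁ := two_mul_sum_cells_content_le (μ := μ)
  rw [sum_cells_content] at h₁
  have h₂ : (μ.rowLen 0 : ℝ) + cellsBelow μ = μ.card := by
    exact_mod_cast rowLen_zero_add_cellsBelow
  have hn : (0 : ℝ) < μ.card := by positivity
  have h₃ : ((μ.card : ℝ) - 1) * (1 - 2 * descentProb μ 1) ≤ μ.rowLen 0 - 1 := by
    refine le_of_mul_le_mul_left ?_ hn
    linarith
  linarith

theorem descentProb_mul_le (h : 1 ≤ μ.card) :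
    (μ.card - 1) * descentProb μ 1 ≤ cellsBelow μ := by
  have e : ((μ.card : ℝ) - 1) * descentProb μ 1 =
      𝔼 T : StandardTableau μ, ∑ i ∈ Ico 1 μ.card, T.descentIndicator i := by
    rw [expect_sum_comm]
    change _ = ∑ i ∈ Ico 1 μ.card, descentProb μ i
    rw [sum_congr rfl fun i hi => descentProb_eq hi, sum_const, Nat.card_Ico,
      nsmul_eq_mul, Nat.cast_sub h, Nat.cast_one]
  rw [e]
  refine expect_le univ_nonempty fun T _ => ?_
  rw [T.sum_descentIndicator]
  exact_mod_cast card_descentSet_le T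

/-- The left side is the mean of the product of the numbers of descents in [1, a] and in [a + 2, n -
1]. All pairs across these blocks have gap at least 2. -/
theorem card_mul_descentPairProb_le {a : ℕ} (ha : a + 2 ≤ μ.card) :
    (a : ℝ) * (μ.card - 2 - a : ℕ) * descentPairProb μ 1 3 ≤ (cellsBelow μ : ℝ) ^ 2 := by
  have e : (a : ℝ) * (μ.card - 2 - a : ℕ) * descentPairProb μ 1 3 =
      𝔼 T : StandardTableau μ, (∑ i ∈ Ico 1 (a + 1), T.descentIndicator i) *
        ∑ j ∈ Ico (a + 2) μ.card, T.descentIndicator j := by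
    simp only [sum_mul_sum, expect_sum_comm]
    have : ∀ i ∈ Ico 1 (a + 1), ∀ j ∈ Ico (a + 2) μ.card,
        𝔼 T : StandardTableau μ, T.descentIndicator i * T.descentIndicator j =
          descentPairProb μ 1 3 := fun i hi j hj => by
      rw [mem_Ico] at hi hj
      exact descentPairProb_eq hi.1 (by omega) hj.2
    rw [sum_congr rfl fun i hi => sum_congr rfl (this i hi)]
    simp only [sum_const, Nat.card_Ico, nsmul_eq_mul]
    rw [show a + 1 - 1 = a by omega, show μ.card - (a + 2) = μ.card - 2 - a by omega, mul_assoc]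
  rw [e]
  refine expect_le univ_nonempty fun T _ => ?_
  have hT : ∀ s ⊆ Ico 1 μ.card, ∑ i ∈ s, T.descentIndicator i ≤ cellsBelow μ := fun s hs => by
    refine (sum_le_sum_of_subset_of_nonneg hs fun i _ _ => T.descentIndicator_nonneg i).trans ?_
    rw [T.sum_descentIndicator]
    exact_mod_cast card_descentSet_le T
  rw [sq]
  refine mul_le_mul (hT _ fun i hi => ?_) (hT _ fun i hi => ?_)
    (sum_nonneg fun i _ => T.descentIndicator_nonneg i) (Nat.cast_nonneg _)
  · rw [mem_Ico] at hi ⊢; omega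
  · rw [mem_Ico] at hi ⊢; omega

theorem descentPairProb_le_sq : descentPairProb μ 1 3 ≤ 48 * descentProb μ 1 ^ 2 := by
  rcases lt_or_ge μ.card 4 with h | h
  · have : descentPairProb μ 1 3 = 0 := expect_eq_zero fun T _ => by
      have : 3 ∉ descentSet T := fun h' => by
        have := (mem_Ico.1 (mem_filter.1 h').1).2
        omega
      rw [descentIndicator, descentIndicator, if_neg this, mul_zero]
    rw [this]
    positivity
  -- Balanced blocks make the number of pairs at least (n - 1)²/12; then 48 = 12 · 2², the 2 coming
  -- from `cellsBelow_le_descentProb`.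
  · have h₁ := card_mul_descentPairProb_le (μ := μ) (a := (μ.card - 2) / 2) (by omega)
    have h₂ := cellsBelow_le_descentProb (μ := μ) (by omega)
    have h₃ : ((μ.card : ℝ) - 1) ^ 2 ≤
        12 * (((μ.card - 2) / 2 : ℕ) * (μ.card - 2 - (μ.card - 2) / 2 : ℕ)) := by
      obtain ⟨t, ht, e⟩ : ∃ t, 1 ≤ t ∧ (μ.card = 2 * t + 2 ∨ μ.card = 2 * t + 3) :=
        ⟨(μ.card - 2) / 2, by omega, by omega⟩
      have ht' : (1 : ℝ) ≤ t := by exact_mod_cast ht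
      rcases e with e | e
      · rw [show (μ.card - 2) / 2 = t by omega, show μ.card - 2 - t = t by omega, e]
        push_cast; nlinarith
      · rw [show (μ.card - 2) / 2 = t by omega, show μ.card - 2 - t = t + 1 by omega, e]
        push_cast; nlinarith
    have hn : (0 : ℝ) < (μ.card - 1) ^ 2 := by
      have : (4 : ℝ) ≤ μ.card := by exact_mod_cast h
      have : (0 : ℝ) < μ.card - 1 := by linarith
      positivity
    have h₄ : (cellsBelow μ : ℝ) ^ 2 ≤ (2 * (μ.card - 1) * descentProb μ 1) ^ 2 :=
      pow_le_pow_left₀ (Nat.cast_nonneg _) h₂ 2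
    refine le_of_mul_le_mul_left ?_ hn
    calc ((μ.card : ℝ) - 1) ^ 2 * descentPairProb μ 1 3
        ≤ 12 * (((μ.card - 2) / 2 : ℕ) * (μ.card - 2 - (μ.card - 2) / 2 : ℕ)) *
          descentPairProb μ 1 3 := mul_le_mul_of_nonneg_right h₃ (descentPairProb_nonneg _ _)
      _ ≤ 12 * (2 * (μ.card - 1) * descentProb μ 1) ^ 2 := by linarith
      _ = (μ.card - 1) ^ 2 * (48 * descentProb μ 1 ^ 2) := by ring

/-! ### Second moment and variance -/

theorem sum_sum_near_le (f : ℕ → ℝ) (s : Finset ℕ) :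
    ∑ i ∈ s, ∑ j ∈ s, (if i ≤ j + 1 ∧ j ≤ i + 1 then (f i ^ 2 + f j ^ 2) / 2 else 0) ≤
      3 * ∑ i ∈ s, f i ^ 2 := by
  have half : ∑ i ∈ s, ∑ j ∈ s, (if i ≤ j + 1 ∧ j ≤ i + 1 then f i ^ 2 / 2 else 0) ≤
      3 / 2 * ∑ i ∈ s, f i ^ 2 := by
    rw [mul_sum]
    refine sum_le_sum fun i _ => ?_
    rw [← sum_filter, sum_const, nsmul_eq_mul]
    have hc : (s.filter fun j => i ≤ j + 1 ∧ j ≤ i + 1).card ≤ 3 := by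
      refine (card_le_card (t := Icc (i - 1) (i + 1)) fun j hj => ?_).trans ?_
      · have := (mem_filter.1 hj).2
        rw [mem_Icc]; omega
      · rw [Nat.card_Icc]; omega
    have hc' : ((s.filter fun j => i ≤ j + 1 ∧ j ≤ i + 1).card : ℝ) ≤ 3 := by exact_mod_cast hc
    nlinarith [sq_nonneg (f i)]
  have half' : ∑ i ∈ s, ∑ j ∈ s, (if i ≤ j + 1 ∧ j ≤ i + 1 then f j ^ 2 / 2 else 0) ≤
      3 / 2 * ∑ i ∈ s, f i ^ 2 := by
    rw [sum_comm]
    simpa only [and_comm] using half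
  have e : ∀ i j, (if i ≤ j + 1 ∧ j ≤ i + 1 then (f i ^ 2 + f j ^ 2) / 2 else 0) =
      (if i ≤ j + 1 ∧ j ≤ i + 1 then f i ^ 2 / 2 else 0) +
        (if i ≤ j + 1 ∧ j ≤ i + 1 then f j ^ 2 / 2 else 0) := fun i j => by
    split_ifs <;> ring
  simp only [e, sum_add_distrib]
  linarith

/-- Pairs at distance at most 1 are bounded by p and the arithmetic-geometric mean inequality, each
index having at most three such partners; all other pairs have probability q ≤ 48p². -/
theorem expect_descentFunction_sq_le {f : ℕ → ℝ} (hf : ∀ i, 1 ≤ i → 0 < f i) :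
    𝔼 T : StandardTableau μ, descentFunction f T ^ 2 ≤
      3 * descentProb μ 1 * ∑ i ∈ Ico 1 μ.card, f i ^ 2 +
        48 * descentProb μ 1 ^ 2 * (∑ i ∈ Ico 1 μ.card, f i) ^ 2 := by
  have hp := descentProb_nonneg (μ := μ) 1
  have term : ∀ i ∈ Ico 1 μ.card, ∀ j ∈ Ico 1 μ.card, f i * f j * descentPairProb μ i j ≤
      descentProb μ 1 * (if i ≤ j + 1 ∧ j ≤ i + 1 then (f i ^ 2 + f j ^ 2) / 2 else 0) +
        48 * descentProb μ 1 ^ 2 * (f i * f j) := by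
    intro i hi j hj
    have hfij : 0 < f i * f j := mul_pos (hf i (mem_Ico.1 hi).1) (hf j (mem_Ico.1 hj).1)
    split_ifs with h
    · have h₁ := (descentPairProb_le (μ := μ) i j).trans_eq (descentProb_eq hi)
      have h₂ := mul_le_mul_of_nonneg_left h₁ hfij.le
      have h₃ := mul_nonneg hp (sq_nonneg (f i - f j))
      have h₄ : 0 ≤ 48 * descentProb μ 1 ^ 2 * (f i * f j) := by positivity
      linarith
    · have h₁ : descentPairProb μ i j = descentPairProb μ 1 3 := by
        rw [mem_Ico] at hi hj
        rcases le_total i j with hij | hij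
        · exact descentPairProb_eq hi.1 (by omega) hj.2
        · rw [descentPairProb_comm]
          exact descentPairProb_eq hj.1 (by omega) hi.2
      rw [h₁, mul_zero, zero_add, mul_comm]
      exact mul_le_mul_of_nonneg_right descentPairProb_le_sq hfij.le
  rw [expect_descentFunction_sq]
  refine (sum_le_sum fun i hi => sum_le_sum (term i hi)).trans ?_
  simp only [sum_add_distrib, ← mul_sum]
  rw [← sum_mul, ← sq]
  have := mul_le_mul_of_nonneg_left (sum_sum_near_le f (Ico 1 μ.card)) hp
  linarith

theorem normalizedVariance_le {f : ℕ → ℝ} (hf : ∀ i, 1 ≤ i → 0 < f i) {c : ℝ}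
    (h : (μ.card : ℝ) * ∑ i ∈ Ico 1 μ.card, f i ^ 2 ≤ c * (∑ i ∈ Ico 1 μ.card, f i) ^ 2)
    (hμ : 2 ≤ μ.colLen 0) : |normalizedVariance μ f| ≤ 6 * c + 48 := by
  have hn := two_le_card hμ
  have hS : 0 < ∑ i ∈ Ico 1 μ.card, f i :=
    sum_pos (fun i hi => hf i (mem_Ico.1 hi).1) ⟨1, by simp; omega⟩
  have hk : (1 : ℝ) ≤ cellsBelow μ := by exact_mod_cast cellsBelow_pos hμ
  have hkp := cellsBelow_le_descentProb hn
  have hn' : (2 : ℝ) ≤ μ.card := by exact_mod_cast hn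
  have hp0 := descentProb_nonneg (μ := μ) 1
  have hp1 : 1 ≤ 2 * μ.card * descentProb μ 1 := by linarith
  have hp : 0 < descentProb μ 1 := by
    refine hp0.lt_of_ne fun h0 => ?_
    rw [← h0] at hp1
    linarith
  have hE : 0 < descentExpectation μ f ^ 2 := by
    rw [descentExpectation_eq]
    positivity
  rw [normalizedVariance, abs_of_nonneg (div_nonneg (descentVariance_nonneg f) hE.le),
    div_le_iff₀ hE, descentVariance_eq]
  have h₁ := expect_descentFunction_sq_le (μ := μ) hf
  have hQ : 0 ≤ ∑ i ∈ Ico 1 μ.card, f i ^ 2 := sum_nonneg fun i _ => sq_nonneg _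
  -- The missing factor p is supplied by 1 ≤ 2np; this makes the constant 6 = 3 · 2.
  have h₂ : descentProb μ 1 * ∑ i ∈ Ico 1 μ.card, f i ^ 2 ≤
      2 * descentProb μ 1 ^ 2 * (c * (∑ i ∈ Ico 1 μ.card, f i) ^ 2) := by
    calc descentProb μ 1 * ∑ i ∈ Ico 1 μ.card, f i ^ 2
        ≤ (2 * μ.card * descentProb μ 1) * (descentProb μ 1 * ∑ i ∈ Ico 1 μ.card, f i ^ 2) :=
          le_mul_of_one_le_left (mul_nonneg hp0 hQ) hp1
      _ = 2 * descentProb μ 1 ^ 2 * (μ.card * ∑ i ∈ Ico 1 μ.card, f i ^ 2) := by ring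
      _ ≤ _ := mul_le_mul_of_nonneg_left h (by positivity)
  rw [descentExpectation_eq] at hE ⊢
  nlinarith

/-- If only one cell lies below the first row, then a tableau has at most one descent. -/
theorem card_mul_sum_sq_le {f : ℕ → ℝ} (hf : ∀ i, 1 ≤ i → 0 < f i) (hμ : 2 ≤ μ.colLen 0)
    (h : cellsBelow μ = 1) {C : ℝ} (hC : normalizedVariance μ f ≤ C) :
    (μ.card : ℝ) * ∑ i ∈ Ico 1 μ.card, f i ^ 2 ≤
      2 * (C + 1) * (∑ i ∈ Ico 1 μ.card, f i) ^ 2 := by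
  have hn := two_le_card hμ
  have hn' : (2 : ℝ) ≤ μ.card := by exact_mod_cast hn
  have hS : 0 < ∑ i ∈ Ico 1 μ.card, f i :=
    sum_pos (fun i hi => hf i (mem_Ico.1 hi).1) ⟨1, by simp; omega⟩
  have hlow := cellsBelow_le_descentProb hn
  have hup := descentProb_mul_le (μ := μ) (by omega)
  rw [h, Nat.cast_one] at hlow hup
  have hp0 := descentProb_nonneg (μ := μ) 1
  have hp : 0 < descentProb μ 1 := by
    refine hp0.lt_of_ne fun h0 => ?_
    rw [← h0] at hlow
    linarith
  have hE : 0 < descentExpectation μ f ^ 2 := by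
    rw [descentExpectation_eq]
    positivity
  have hQ : 0 ≤ ∑ i ∈ Ico 1 μ.card, f i ^ 2 := sum_nonneg fun i _ => sq_nonneg _
  -- Only the diagonal terms of the second moment are kept.
  have hsq : descentProb μ 1 * ∑ i ∈ Ico 1 μ.card, f i ^ 2 ≤
      𝔼 T : StandardTableau μ, descentFunction f T ^ 2 := by
    rw [expect_descentFunction_sq, mul_sum]
    refine sum_le_sum fun i hi => ?_
    have : f i * f i * descentPairProb μ i i = descentProb μ 1 * f i ^ 2 := by
      rw [descentPairProb_self, descentProb_eq hi]; ring
    rw [← this]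
    exact single_le_sum (f := fun j => f i * f j * descentPairProb μ i j)
      (fun j hj => mul_nonneg (mul_pos (hf i (mem_Ico.1 hi).1) (hf j (mem_Ico.1 hj).1)).le
        (descentPairProb_nonneg i j)) hi
  rw [normalizedVariance, div_le_iff₀ hE, descentVariance_eq, descentExpectation_eq] at hC
  have h₁ : ∑ i ∈ Ico 1 μ.card, f i ^ 2 ≤
      (C + 1) * (descentProb μ 1 * (∑ i ∈ Ico 1 μ.card, f i) ^ 2) := by
    refine le_of_mul_le_mul_left ?_ hp
    linarith
  have h₂ : 0 ≤ (C + 1) * (∑ i ∈ Ico 1 μ.card, f i) ^ 2 := by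
    have : 0 ≤ descentProb μ 1 * ((C + 1) * (∑ i ∈ Ico 1 μ.card, f i) ^ 2) := by linarith
    exact nonneg_of_mul_nonneg_right this hp
  calc (μ.card : ℝ) * ∑ i ∈ Ico 1 μ.card, f i ^ 2
      ≤ 2 * (μ.card - 1) * ∑ i ∈ Ico 1 μ.card, f i ^ 2 :=
        mul_le_mul_of_nonneg_right (by linarith) hQ
    _ ≤ 2 * (μ.card - 1) * ((C + 1) * (descentProb μ 1 * (∑ i ∈ Ico 1 μ.card, f i) ^ 2)) :=
        mul_le_mul_of_nonneg_left h₁ (by linarith)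
    _ = 2 * ((μ.card - 1) * descentProb μ 1) * ((C + 1) * (∑ i ∈ Ico 1 μ.card, f i) ^ 2) := by
        ring
    _ ≤ 2 * 1 * ((C + 1) * (∑ i ∈ Ico 1 μ.card, f i) ^ 2) := by gcongr
    _ = _ := by ring

/-- The diagram of the partition `(n - 1, 1)` has a single cell below its first row. -/
theorem exists_youngDiagram_cellsBelow_eq_one {n : ℕ} (hn : 2 ≤ n) :
    ∃ ν : YoungDiagram, ν.card = n ∧ 2 ≤ ν.colLen 0 ∧ cellsBelow ν = 1 := by
  let ν : YoungDiagram :=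
    { cells := insert (1, 0) ((range (n - 1)).image fun j => (0, j))
      isLowerSet := by
        rintro ⟨a, b⟩ ⟨c, d⟩ ⟨h₁, h₂⟩ h
        simp only [coe_insert, coe_image, coe_range, Set.mem_insert_iff, Set.mem_image,
          Set.mem_Iio, Prod.mk.injEq] at h h₁ h₂ ⊢
        rcases h with ⟨rfl, rfl⟩ | ⟨j, hj, rfl, rfl⟩
        · rcases Nat.le_one_iff_eq_zero_or_eq_one.1 h₁ with rfl | rfl
          · exact Or.inr ⟨d, by omega, rfl, rfl⟩
          · exact Or.inl ⟨rfl, Nat.le_zero.1 h₂⟩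
        · exact Or.inr ⟨d, by omega, by omega, rfl⟩ }
  refine ⟨ν, ?_, YoungDiagram.mem_iff_lt_colLen.1 (mem_insert_self _ _), ?_⟩
  · change (insert ((1, 0) : ℕ × ℕ) ((range (n - 1)).image fun j => (0, j))).card = n
    rw [card_insert_of_notMem (by simp), card_image_of_injective _ (Prod.mk_right_injective 0),
      card_range]
    omega
  · refine card_eq_one.2 ⟨(1, 0), ?_⟩
    ext ⟨a, b⟩
    simp only [ν, mem_filter, mem_insert, mem_image, Prod.mk.injEq, mem_singleton]
    constructor
    · rintro ⟨h | ⟨_, _, h, _⟩, h'⟩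
      · exact h
      · omega
    · exact fun h => ⟨Or.inl h, by omega⟩

/-! ### Normalized norms and the equivalence -/

theorem normalizedLpNorm_one {f : ℕ → ℝ} (hf : ∀ i, 1 ≤ i → 0 < f i) (n : ℕ) :
    normalizedLpNorm 1 n f = (∑ i ∈ Ico 1 n, f i) / (n - 1 : ℕ) := by
  rw [normalizedLpNorm, div_one, Real.rpow_one, expect_eq_sum_div_card, Nat.card_Ico]
  congr 1
  exact sum_congr rfl fun i hi => by rw [Real.rpow_one, abs_of_pos (hf i (mem_Ico.1 hi).1)]

theorem normalizedLpNorm_two (f : ℕ → ℝ) (n : ℕ) :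
    normalizedLpNorm 2 n f = √((∑ i ∈ Ico 1 n, f i ^ 2) / (n - 1 : ℕ)) := by
  rw [normalizedLpNorm, ← Real.sqrt_eq_rpow, expect_eq_sum_div_card, Nat.card_Ico]
  simp only [Real.rpow_two, sq_abs]

theorem normalizedLpNorm_two_le_iff {f : ℕ → ℝ} (hf : ∀ i, 1 ≤ i → 0 < f i) {n : ℕ} (hn : 2 ≤ n)
    {c : ℝ} (hc : 0 ≤ c) : normalizedLpNorm 2 n f ≤ c * normalizedLpNorm 1 n f ↔
      ((n : ℝ) - 1) * ∑ i ∈ Ico 1 n, f i ^ 2 ≤ c ^ 2 * (∑ i ∈ Ico 1 n, f i) ^ 2 := by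
  have hn' : (0 : ℝ) < n - 1 := by
    have : (2 : ℝ) ≤ n := by exact_mod_cast hn
    linarith
  have hS : 0 ≤ ∑ i ∈ Ico 1 n, f i := sum_nonneg fun i hi => (hf i (mem_Ico.1 hi).1).le
  rw [normalizedLpNorm_one hf, normalizedLpNorm_two, Nat.cast_sub (by omega), Nat.cast_one,
    Real.sqrt_le_left (by positivity), div_le_iff₀ hn']
  rw [show (c * ((∑ i ∈ Ico 1 n, f i) / ((n : ℝ) - 1))) ^ 2 * (n - 1) =
    c ^ 2 * (∑ i ∈ Ico 1 n, f i) ^ 2 / (n - 1) by field_simp, le_div_iff₀ hn', mul_comm]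

/-- The sequences range over all sequences of partitions with at least two rows: for a one-row
shape the descent functions vanish identically and `V / E²` is not defined. -/
theorem mainTheorem3 (f : ℕ → ℝ) (hf : ∀ i : ℕ, 1 ≤ i → 0 < f i) :
    ((∀ lam : ℕ → YoungDiagram, (∀ m : ℕ, 2 ≤ (lam m).colLen 0) →
        ∃ C : ℝ, ∀ m : ℕ, |normalizedVariance (lam m) f| ≤ C) ↔
      ∃ c : ℝ, ∀ n : ℕ, 2 ≤ n →
        (n : ℝ) * ∑ i ∈ Finset.Ico 1 n, f i ^ 2 ≤ c * (∑ i ∈ Finset.Ico 1 n, f i) ^ 2) ∧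
    ((∃ c : ℝ, ∀ n : ℕ, 2 ≤ n →
        (n : ℝ) * ∑ i ∈ Finset.Ico 1 n, f i ^ 2 ≤ c * (∑ i ∈ Finset.Ico 1 n, f i) ^ 2) ↔
      ∃ c : ℝ, ∀ n : ℕ, 2 ≤ n →
        normalizedLpNorm 2 n f ≤ c * normalizedLpNorm 1 n f) := by
  have hQ : ∀ n, 0 ≤ ∑ i ∈ Ico 1 n, f i ^ 2 := fun n => sum_nonneg fun i _ => sq_nonneg _
  refine ⟨⟨fun h => ?_, fun ⟨c, hc⟩ lam hlam => ?_⟩, fun ⟨c, hc⟩ => ?_, fun ⟨c, hc⟩ => ?_⟩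
  -- A single sequence, with one shape of each size `m + 2`, covers all n ≥ 2 with one bound `C`.
  · choose ν hcard hcol hbelow using fun m : ℕ =>
      exists_youngDiagram_cellsBelow_eq_one (n := m + 2) (Nat.le_add_left 2 m)
    obtain ⟨C, hC⟩ := h ν hcol
    refine ⟨2 * (C + 1), fun n hn => ?_⟩
    obtain ⟨m, rfl⟩ := Nat.exists_eq_add_of_le' hn
    have := card_mul_sum_sq_le hf (hcol m) (hbelow m) ((le_abs_self _).trans (hC m))
    rwa [hcard] at this
  · exact ⟨6 * c + 48, fun m =>
      normalizedVariance_le hf (hc _ (two_le_card (hlam m))) (hlam m)⟩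
  -- The absolute value spares a proof that `c` is nonnegative.
  · refine ⟨√|c|, fun n hn => ?_⟩
    rw [normalizedLpNorm_two_le_iff hf hn (Real.sqrt_nonneg _), Real.sq_sqrt (abs_nonneg c)]
    have := hc n hn
    have := mul_le_mul_of_nonneg_right (le_abs_self c) (sq_nonneg (∑ i ∈ Ico 1 n, f i))
    linarith [hQ n]
  -- The factor 2 pays for n ≤ 2(n - 1).
  · refine ⟨2 * |c| ^ 2, fun n hn => ?_⟩
    have hn' : (2 : ℝ) ≤ n := by exact_mod_cast hn
    have hN : 0 ≤ normalizedLpNorm 1 n f := by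
      rw [normalizedLpNorm_one hf]
      exact div_nonneg (sum_nonneg fun i hi => (hf i (mem_Ico.1 hi).1).le) (Nat.cast_nonneg _)
    have h₁ := (normalizedLpNorm_two_le_iff hf hn (abs_nonneg c)).1
      ((hc n hn).trans (mul_le_mul_of_nonneg_right (le_abs_self c) hN))
    have h₂ : (n : ℝ) * ∑ i ∈ Ico 1 n, f i ^ 2 ≤ 2 * (n - 1) * ∑ i ∈ Ico 1 n, f i ^ 2 :=
      mul_le_mul_of_nonneg_right (by linarith) (hQ n)
    linarith
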